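/- Let $a\in\mathbb R$ and write $s=\sigma+i\tau$. Let $h$ be a meromorphic function on $\mathbb C$ with finitely many poles in $\mathbb C$ and finitely many zeros in the half-plane $\sigma>a$, holomorphic and nowhere zero on the line $\sigma=a$. For a meromorphic function $g$ put $\overline g(s)=\overline{g(\overline s)}$. Fix a sign and define the meromorphic functions $$f(s)=h(s)\pm\overline h(2a-s),\qquad F(s)=\frac{\overline h(2a-s)}{h(s)} .$$ Assume that (i) for each $\eta>0$ there is $\sigma_0>a$ such that $|F(s)|<\eta$ for all $s$ with $\sigma\ge\sigma_0$, $\tau\in\mathbb R$; (ii) for each $\varepsilon>0$ and each $\sigma_0>a$ there are two real sequences $(T_n)_n$, $(T_n^*)_n$, both tending to $+\infty$, such that $|F(s)|<e^{\varepsilon|s|}$ whenever $a\le\sigma\le\sigma_0$ and ($\tau=T_n$ or $\tau=-T_n^*$) for some $n$. (An inequality for $|F(s)|$ includes that $s$ is not a pole of $F$.) For $T>0$ let $\hat N(T)$ be the number of zeros of $f$ with $|\tau|<T$ and $\hat N_0(T)$ the number of zeros of $f$ with $\sigma=a$, $|\tau|<T$, both counted with multiplicity, and let $\hat N_0'(T)$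 be the number of distinct zeros of $f$ with $\sigma=a$, $|\tau|<T$. For a meromorphic function $m$ let $N_{m,\sigma>a}$ and $P_{m,\sigma>a}$ be the numbers of zeros and of poles of $m$ in $\sigma>a$, counted with multiplicity. Then $\overline f(2a-s)=\pm f(s)$ (with the sign from the definition of $f$), the numbers $P_{f,\sigma>a}$ and $\hat N(T)$ are finite, and for every $T>0$ $$\hat N(T)-\hat N_0(T)\ \le\ \hat N(T)-\hat N_0'(T)\ \le\ 1+2P_{f,\sigma>a}+2N_{h,\sigma>a}-2P_{h,\sigma>a}.$$ Moreover $\hat N(T)-\hat N_0(T)$ is a non-negative even integer for every $T>0$, and all but finitely many zeros of $f$ lie on the line $\sigma=a$ and are simple. -/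

import Mathlib

open Filter Topology

noncomputable section

namespace ZeroCount

/-- The function `s ↦ conj (h (conj s))`. -/
def conjFun (h : ℂ → ℂ) : ℂ → ℂ := fun s =>
  (starRingEnd ℂ) (h ((starRingEnd ℂ) s))

/-- The function `s ↦ h̄(2a - s)`, where `h̄ = conjFun h`. -/
def reflected (a : ℝ) (h : ℂ → ℂ) : ℂ → ℂ := fun s =>
  conjFun h (2 * (a : ℂ) - s)

/-- The function `f(s) = h(s) + ε h̄(2a - s)`; it is used for `ε = 1` and `ε = -1`. -/
def symmetrized (a : ℝ) (ε : ℂ) (h : ℂ → ℂ) : ℂ → ℂ := fun s =>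
  h s + ε * reflected a h s

/-- The quotient `F(s) = h̄(2a - s) / h(s)`. -/
def symQuotient (a : ℝ) (h : ℂ → ℂ) : ℂ → ℂ := fun s =>
  reflected a h s / h s

/-- `|F(s)| < r` for a meromorphic function `F`: the point `s` is not a pole of `F`, and the
value at `s` of `F`, after removing a possible removable singularity there, has modulus less
than `r`. (`toMeromorphicNFAt F s` is `F`, corrected at the point `s` if needed, so this does
not depend on the values which the Lean function `F` takes at its isolated singularities.) -/
def AbsLt (F : ℂ → ℂ) (s : ℂ) (r : ℝ) : Prop :=
  0 ≤ meromorphicOrderAt F s ∧ ‖toMeromorphicNFAt F s s‖ < r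

/-- The zeros, in the set `S`, of the meromorphic function `m`. -/
def zerosIn (m : ℂ → ℂ) (S : Set ℂ) : Set ℂ :=
  {z | z ∈ S ∧ 0 < meromorphicOrderAt m z}

/-- The poles, in the set `S`, of the meromorphic function `m`. -/
def polesIn (m : ℂ → ℂ) (S : Set ℂ) : Set ℂ :=
  {z | z ∈ S ∧ meromorphicOrderAt m z < 0}

/-- The number of zeros of `m` in `S`, counted with multiplicity
(for a finite set of zeros, each of finite order). -/
def numZeros (m : ℂ → ℂ) (S : Set ℂ) : ℤ :=
  ∑ᶠ z ∈ zerosIn m S, (meromorphicOrderAt m z).untop₀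

/-- The number of poles of `m` in `S`, counted with multiplicity
(for a finite set of poles). -/
def numPoles (m : ℂ → ℂ) (S : Set ℂ) : ℤ :=
  ∑ᶠ z ∈ polesIn m S, -(meromorphicOrderAt m z).untop₀

/-- The number of zeros of `m` in `S`, counted without multiplicity
(for a finite set of zeros). -/
def numDistinctZeros (m : ℂ → ℂ) (S : Set ℂ) : ℤ :=
  ((zerosIn m S).ncard : ℤ)

/-- The half-plane `Re s > a`. -/
def rightHalfPlane (a : ℝ) : Set ℂ := {s | a < s.re}

/-- The strip `|Im s| < T`. -/
def strip (T : ℝ) : Set ℂ := {s | |s.im| < T}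

/-- The open segment `Re s = a`, `|Im s| < T`. -/
def criticalSegment (a T : ℝ) : Set ℂ := {s | s.re = a ∧ |s.im| < T}

end ZeroCount

end

namespace ZeroCount

/-! Away from isolated points `f = h W` with `W = 1 ± F`, so orders add. The map `s ↦ 2a - conj s`
fixes the critical line, hence `|F| = 1` there and `Re W ≥ 0`, with equality only where `W = 0`. The
growth conditions, the finiteness of the poles of `F` in the closed half-plane and a
Phragmén–Lindelöf argument bound `W` near infinity in `Re s ≥ a` (`exists_bound_regQuotient`).

These two facts force `W` to have at most as many zeros as poles to the right, a zero of order `m`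
on the line counting as `⌊m/2⌋` (`sum_exponents_nonpos`). Otherwise, multiply `W` by a rational
function of constant sign on the line that cancels the chosen zeros and all poles. The product is
holomorphic in the closed half-plane, decays at least quadratically, and its real part has one sign
on the line. Cauchy's theorem makes that real part vanish identically on the line
(`re_eq_zero_of_isBigO`), which is absurd.

Adding the orders of `h` and reflecting in the line turns this into the estimate, even without the
summand 1 (`right_and_line_count_le`). Since the inequality holds for every finite set of zeros, it
also shows that only finitely many zeros are multiple or off the line (`finite_exceptional_right`).
-/

lemma conj_two : (starRingEnd ℂ) 2 = 2 := map_ofNat (starRingEnd ℂ) 2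

/-! ### Reflection in the critical line -/

/-- The reflection of the complex plane in the line `Re s = a`. -/
def mirror (a : ℝ) (z : ℂ) : ℂ := 2 * (a : ℂ) - (starRingEnd ℂ) z

@[simp] lemma mirror_re (a : ℝ) (z : ℂ) : (mirror a z).re = 2 * a - z.re := by
  simp [mirror]

@[simp] lemma mirror_im (a : ℝ) (z : ℂ) : (mirror a z).im = z.im := by
  simp [mirror]

@[simp] lemma mirror_mirror (a : ℝ) (z : ℂ) : mirror a (mirror a z) = z := by
  simp [mirror, conj_two]

lemma mirror_injective (a : ℝ) : Function.Injective (mirror a) :=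
  Function.LeftInverse.injective (mirror_mirror a)

lemma mirror_eq_self {a : ℝ} {z : ℂ} (hz : z.re = a) : mirror a z = z := by
  apply Complex.ext
  · simp [hz]; ring
  · simp

lemma continuous_mirror (a : ℝ) : Continuous (mirror a) :=
  continuous_const.sub Complex.continuous_conj

lemma reflected_eq (a : ℝ) (h : ℂ → ℂ) (s : ℂ) :
    reflected a h s = (starRingEnd ℂ) (h (mirror a s)) := by
  simp [reflected, conjFun, mirror, conj_two]

lemma tendsto_mirror_nhdsNE (a : ℝ) (z : ℂ) :
    Tendsto (mirror a) (𝓝[≠] z) (𝓝[≠] (mirror a z)) :=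
  (continuous_mirror a).continuousAt.continuousWithinAt.tendsto_nhdsWithin
    (fun _ hw => (mirror_injective a).ne hw)

lemma analyticAt_reflected {a : ℝ} {g : ℂ → ℂ} {z : ℂ} (hg : AnalyticAt ℂ g (mirror a z)) :
    AnalyticAt ℂ (reflected a g) z := by
  rw [Complex.analyticAt_iff_eventually_differentiableAt] at hg ⊢
  filter_upwards [(continuous_mirror a).continuousAt.eventually hg] with w hw
  have h1 : DifferentiableAt ℂ (conjFun g) (2 * (a : ℂ) - w) := by
    have h2 : mirror a w = (starRingEnd ℂ) (2 * (a : ℂ) - w) := by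
      simp [mirror, conj_two]
    rw [h2] at hw
    have := hw.conj_conj
    rw [Complex.conj_conj] at this
    exact this
  exact h1.comp w ((differentiableAt_const _).sub differentiableAt_id)

/-- Reflect the local factorization `(s - mirror a z) ^ n * k s`: conjugation turns the linear
factor into `-(w - z)`, and the resulting sign is absorbed into the analytic factor. -/
lemma meromorphicAt_reflected {a : ℝ} {g : ℂ → ℂ} {z : ℂ} (hg : MeromorphicAt g (mirror a z)) :
    MeromorphicAt (reflected a g) z ∧
      meromorphicOrderAt (reflected a g) z = meromorphicOrderAt g (mirror a z) := by
  by_cases htop : meromorphicOrderAt g (mirror a z) = ⊤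
  · have h0 : ∀ᶠ w in 𝓝[≠] z, reflected a g w = 0 := by
      filter_upwards [(tendsto_mirror_nhdsNE a z).eventually
        (meromorphicOrderAt_eq_top_iff.1 htop)] with w hw
      simp [reflected_eq, hw]
    rw [htop]
    refine ⟨(MeromorphicAt.const (0 : ℂ) z).congr ?_, meromorphicOrderAt_eq_top_iff.2 h0⟩
    filter_upwards [h0] with w hw using hw.symm
  · obtain ⟨n, hn⟩ := WithTop.ne_top_iff_exists.1 htop
    obtain ⟨k, hk, hk0, hgk⟩ := (meromorphicOrderAt_eq_int_iff hg).1 hn.symm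
    have key : ∀ᶠ w in 𝓝[≠] z, reflected a g w =
        (w - z) ^ n • ((-1) ^ n * reflected a k w) := by
      filter_upwards [(tendsto_mirror_nhdsNE a z).eventually hgk] with w hw
      have h1 : (starRingEnd ℂ) (mirror a w - mirror a z) = -1 * (w - z) := by
        simp [mirror]
      rw [reflected_eq, hw, smul_eq_mul, map_mul, map_zpow₀, h1, mul_zpow, reflected_eq,
        smul_eq_mul]
      ring
    have hka : AnalyticAt ℂ (fun w => (-1) ^ n * reflected a k w) z :=
      analyticAt_const.mul (analyticAt_reflected hk)
    have hm : MeromorphicAt (reflected a g) z := by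
      refine MeromorphicAt.congr (f := fun w => (w - z) ^ n • ((-1) ^ n * reflected a k w)) ?_
        (by filter_upwards [key] with w hw using hw.symm)
      exact (((MeromorphicAt.id z).sub (MeromorphicAt.const z z)).zpow n).smul hka.meromorphicAt
    refine ⟨hm, ?_⟩
    rw [← hn, meromorphicOrderAt_eq_int_iff hm]
    refine ⟨_, hka, ?_, key⟩
    exact mul_ne_zero (zpow_ne_zero _ (by norm_num)) (by simpa [reflected_eq] using hk0)

/-! ### Phragmén–Lindelöf in half-strips -/

/-- A Phragmén–Lindelöf principle for a half-strip, with growth conditions on a sequence of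
horizontal segments only. -/
lemma exists_bound_upper_half_strip {a b t₀ : ℝ} (hab : a < b) {Φ : ℂ → ℂ}
    (hd : ∀ z : ℂ, a ≤ z.re → z.re ≤ b → t₀ ≤ z.im → DifferentiableAt ℂ Φ z)
    (hside : ∀ z : ℂ, z.re = a ∨ z.re = b → t₀ ≤ z.im → ‖Φ z‖ ≤ 1)
    (hT : ∀ ε : ℝ, 0 < ε → ∃ T : ℕ → ℝ, Tendsto T atTop atTop ∧
      ∀ n, ∀ z : ℂ, a ≤ z.re → z.re ≤ b → z.im = T n → ‖Φ z‖ ≤ Real.exp (ε * ‖z‖)) :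
    ∃ M : ℝ, ∀ z : ℂ, a ≤ z.re → z.re ≤ b → t₀ ≤ z.im → ‖Φ z‖ ≤ M := by
  obtain ⟨M₀, hM₀⟩ : ∃ M₀ : ℝ, ∀ z ∈ (Set.Icc a b ×ℂ {t₀}), ‖Φ z‖ ≤ M₀ := by
    refine (isCompact_Icc.reProdIm isCompact_singleton).exists_bound_of_continuousOn ?_
    intro z hz
    rw [Complex.mem_reProdIm] at hz
    exact (hd z hz.1.1 hz.1.2 (le_of_eq hz.2.symm)).continuousAt.continuousWithinAt
  set M := max 1 M₀
  have hM1 : 1 ≤ M := le_max_left _ _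
  -- `M` does not depend on `ε`, so `ε → 0` removes the exponential at the end.
  have key : ∀ z : ℂ, a ≤ z.re → z.re ≤ b → t₀ ≤ z.im → ∀ ε : ℝ, 0 < ε →
      ‖Φ z‖ ≤ M * Real.exp (2 * ε * (z.im - t₀)) := by
    intro z hza hzb hzt ε hε
    obtain ⟨T, hTt, hTb⟩ := hT ε hε
    -- The threshold `|a| + |b| + 2|t₀|` makes `‖s‖ ≤ 2 (T n - t₀)` on the top edge, so the damping
    -- factor beats the allowed growth there.
    obtain ⟨n, hn⟩ := (hTt.eventually_gt_atTop (max z.im (|a| + |b| + 2 * |t₀|))).exists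
    have hn1 : z.im < T n := (le_max_left _ _).trans_lt hn
    have hn2 : |a| + |b| + 2 * |t₀| < T n := (le_max_right _ _).trans_lt hn
    have hTpos : 0 < T n := lt_of_le_of_lt (by positivity) hn2
    have htT : t₀ < T n := hzt.trans_lt hn1
    set g : ℂ → ℂ := fun s => Φ s * Complex.exp (2 * ε * Complex.I * (s - t₀ * Complex.I))
      with hg
    have hgn : ∀ s, ‖g s‖ = ‖Φ s‖ * Real.exp (-(2 * ε * (s.im - t₀))) := by
      intro s
      rw [hg]
      simp only [norm_mul, Complex.norm_exp]
      congr 2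
      simp
    have hcl : closure (Set.Ioo a b ×ℂ Set.Ioo t₀ (T n)) = Set.Icc a b ×ℂ Set.Icc t₀ (T n) := by
      rw [Complex.closure_reProdIm, closure_Ioo hab.ne, closure_Ioo htT.ne]
    have hbound : ‖g z‖ ≤ M := by
      refine Complex.norm_le_of_forall_mem_frontier_norm_le (U := Set.Ioo a b ×ℂ Set.Ioo t₀ (T n))
        ((Metric.isBounded_Ioo _ _).reProdIm (Metric.isBounded_Ioo _ _)) ?_ ?_ ?_
      · apply DifferentiableOn.diffContOnCl
        rw [hcl]
        intro s hs
        rw [Complex.mem_reProdIm] at hs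
        refine ((hd s hs.1.1 hs.1.2 hs.2.1).mul ?_).differentiableWithinAt
        fun_prop
      · intro s hs
        rw [Complex.frontier_reProdIm, closure_Ioo hab.ne, closure_Ioo htT.ne,
          frontier_Ioo hab, frontier_Ioo htT] at hs
        rw [hgn]
        rcases hs with hs | hs
        · rw [Complex.mem_reProdIm] at hs
          rcases hs.2 with h2 | h2
          · rw [h2]
            simp only [sub_self, mul_zero, neg_zero, Real.exp_zero, mul_one]
            exact (hM₀ s (by rw [Complex.mem_reProdIm]; exact ⟨hs.1, h2⟩)).trans (le_max_right _ _)
          · have h2' : s.im = T n := h2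
            have h3 := hTb n s hs.1.1 hs.1.2 h2'
            have h4 : ‖s‖ ≤ |a| + |b| + T n := by
              have h5 := Complex.norm_le_abs_re_add_abs_im s
              rw [h2', abs_of_pos hTpos] at h5
              have h6 : |s.re| ≤ |a| + |b| := by
                rw [abs_le]
                constructor
                · linarith [hs.1.1, neg_abs_le a, abs_nonneg b]
                · linarith [hs.1.2, le_abs_self b, abs_nonneg a]
              linarith
            calc ‖Φ s‖ * Real.exp (-(2 * ε * (s.im - t₀)))
                ≤ Real.exp (ε * ‖s‖) * Real.exp (-(2 * ε * (s.im - t₀))) := by gcongr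
              _ = Real.exp (ε * (‖s‖ - 2 * (T n - t₀))) := by
                  rw [← Real.exp_add, h2']; ring_nf
              _ ≤ 1 := by
                  rw [Real.exp_le_one_iff]
                  refine mul_nonpos_of_nonneg_of_nonpos hε.le ?_
                  linarith [le_abs_self t₀]
              _ ≤ M := hM1
        · rw [Complex.mem_reProdIm] at hs
          calc ‖Φ s‖ * Real.exp (-(2 * ε * (s.im - t₀))) ≤ 1 * 1 := by
                gcongr
                · exact hside s hs.1 hs.2.1
                · rw [Real.exp_le_one_iff]
                  have : 0 ≤ s.im - t₀ := by linarith [hs.2.1]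
                  have : 0 ≤ 2 * ε * (s.im - t₀) := by positivity
                  linarith
            _ ≤ M := by linarith
      · rw [hcl, Complex.mem_reProdIm]
        exact ⟨⟨hza, hzb⟩, ⟨hzt, hn1.le⟩⟩
    rw [hgn, Real.exp_neg, ← div_eq_mul_inv, div_le_iff₀ (Real.exp_pos _)] at hbound
    exact hbound
  refine ⟨M, fun z hza hzb hzt => ?_⟩
  have hlim : Tendsto (fun ε : ℝ => M * Real.exp (2 * ε * (z.im - t₀))) (𝓝[>] 0) (𝓝 M) := by
    have : ContinuousAt (fun ε : ℝ => M * Real.exp (2 * ε * (z.im - t₀))) 0 := by fun_prop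
    have h2 := this.tendsto
    simp only [mul_zero, zero_mul, Real.exp_zero, mul_one] at h2
    exact h2.mono_left nhdsWithin_le_nhds
  refine ge_of_tendsto hlim ?_
  filter_upwards [self_mem_nhdsWithin] with ε hε using key z hza hzb hzt ε hε

/-- Complex conjugation carries this to the upper half-strip. -/
lemma exists_bound_lower_half_strip {a b t₀ : ℝ} (hab : a < b) {Φ : ℂ → ℂ}
    (hd : ∀ z : ℂ, a ≤ z.re → z.re ≤ b → z.im ≤ -t₀ → DifferentiableAt ℂ Φ z)
    (hside : ∀ z : ℂ, z.re = a ∨ z.re = b → z.im ≤ -t₀ → ‖Φ z‖ ≤ 1)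
    (hT : ∀ ε : ℝ, 0 < ε → ∃ T : ℕ → ℝ, Tendsto T atTop atTop ∧
      ∀ n, ∀ z : ℂ, a ≤ z.re → z.re ≤ b → z.im = -T n → ‖Φ z‖ ≤ Real.exp (ε * ‖z‖)) :
    ∃ M : ℝ, ∀ z : ℂ, a ≤ z.re → z.re ≤ b → z.im ≤ -t₀ → ‖Φ z‖ ≤ M := by
  have hup : ∃ M : ℝ, ∀ z : ℂ, a ≤ z.re → z.re ≤ b → t₀ ≤ z.im → ‖conjFun Φ z‖ ≤ M := by
    refine exists_bound_upper_half_strip hab (fun z h1 h2 h3 => ?_) (fun z h1 h2 => ?_)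
      (fun ε hε => ?_)
    · have h4 := (hd ((starRingEnd ℂ) z) (by simpa) (by simpa) (by simpa)).conj_conj
      rwa [Complex.conj_conj] at h4
    · simpa [conjFun] using hside ((starRingEnd ℂ) z) (by simpa) (by simpa)
    · obtain ⟨T, hT1, hT2⟩ := hT ε hε
      refine ⟨T, hT1, fun n z h1 h2 h3 => ?_⟩
      simpa [conjFun] using hT2 n ((starRingEnd ℂ) z) (by simpa) (by simpa) (by simp [h3])
  obtain ⟨M, hM⟩ := hup
  refine ⟨M, fun z h1 h2 h3 => ?_⟩
  have := hM ((starRingEnd ℂ) z) (by simpa) (by simpa) (by rw [Complex.conj_im]; linarith)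
  simpa [conjFun] using this

/-! ### Mirror products -/

/-- The product of the functions `((z - p) (z - mirror a p)) ^ (-e p)`. -/
noncomputable def mirrorProd (a : ℝ) (A : Finset ℂ) (e : ℂ → ℤ) : ℂ → ℂ := fun z =>
  ∏ p ∈ A, ((z - p) * (z - mirror a p)) ^ (-e p)

lemma meromorphicOrderAt_sub_const_of_ne {p q : ℂ} (hpq : q ≠ p) :
    meromorphicOrderAt (fun z : ℂ => z - p) q = 0 := by
  have h1 : AnalyticAt ℂ (fun z : ℂ => z - p) q := by fun_prop
  exact h1.meromorphicNFAt.meromorphicOrderAt_eq_zero_iff.2 (sub_ne_zero.2 hpq)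

lemma mirror_eq_iff {a : ℝ} {p q : ℂ} (hp : a ≤ p.re) (hq : a ≤ q.re) :
    q = mirror a p ↔ q = p ∧ q.re = a := by
  constructor
  · intro h
    have h1 : q.re = 2 * a - p.re := by rw [h]; simp
    have h2 : q.re = a := by linarith
    have h3 : p.re = a := by linarith
    exact ⟨by rw [h, mirror_eq_self h3], h2⟩
  · rintro ⟨rfl, h⟩
    exact (mirror_eq_self h).symm

lemma meromorphicAt_mirrorProd (a : ℝ) (A : Finset ℂ) (e : ℂ → ℤ) (q : ℂ) :
    MeromorphicAt (mirrorProd a A e) q := by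
  unfold mirrorProd
  refine MeromorphicAt.fun_prod fun p _ => ?_
  have h1 : MeromorphicAt (fun z : ℂ => (z - p) * (z - mirror a p)) q := by fun_prop
  exact h1.zpow _

/-- A point on the line is its own mirror image, so its factor is a square. This is the source of
the weight 2 on the line throughout. -/
lemma meromorphicOrderAt_mirror_factor {a : ℝ} {p q : ℂ} (hp : a ≤ p.re) (hq : a ≤ q.re) :
    meromorphicOrderAt (fun z : ℂ => (z - p) * (z - mirror a p)) q =
      if q = p then (if q.re = a then 2 else 1) else 0 := by
  have h1 : MeromorphicAt (fun z : ℂ => z - p) q := by fun_prop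
  have h2 : MeromorphicAt (fun z : ℂ => z - mirror a p) q := by fun_prop
  rw [show (fun z : ℂ => (z - p) * (z - mirror a p)) =
    (fun z : ℂ => z - p) * (fun z : ℂ => z - mirror a p) from rfl, meromorphicOrderAt_mul h1 h2]
  by_cases hqp : q = p
  · subst hqp
    rw [if_pos rfl, meromorphicOrderAt_id_sub_const]
    split_ifs with h
    · rw [mirror_eq_self h, meromorphicOrderAt_id_sub_const]; rfl
    · rw [meromorphicOrderAt_sub_const_of_ne (fun h' => h ((mirror_eq_iff hp hq).1 h').2),
        add_zero]
  · rw [if_neg hqp, meromorphicOrderAt_sub_const_of_ne hqp,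
      meromorphicOrderAt_sub_const_of_ne (fun h' => hqp ((mirror_eq_iff hp hq).1 h').1), add_zero]

lemma meromorphicOrderAt_mirrorProd {a : ℝ} {A : Finset ℂ} (hA : ∀ p ∈ A, a ≤ p.re) (e : ℂ → ℤ)
    {q : ℂ} (hq : a ≤ q.re) :
    meromorphicOrderAt (mirrorProd a A e) q =
      if q ∈ A then (((if q.re = a then 2 else 1) * -e q : ℤ) : WithTop ℤ) else 0 := by
  have hm : ∀ p : ℂ, MeromorphicAt (fun z : ℂ => (z - p) * (z - mirror a p)) q := by
    intro p; fun_prop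
  have h1 : meromorphicOrderAt (mirrorProd a A e) q =
      ∑ p ∈ A, meromorphicOrderAt (fun z : ℂ => ((z - p) * (z - mirror a p)) ^ (-e p)) q :=
    meromorphicOrderAt_fun_prod fun p _ => (hm p).zpow _
  have h2 : ∀ p ∈ A, meromorphicOrderAt (fun z : ℂ => ((z - p) * (z - mirror a p)) ^ (-e p)) q =
      if q = p then (((if q.re = a then 2 else 1) * -e q : ℤ) : WithTop ℤ) else 0 := by
    intro p hp
    rw [show (fun z : ℂ => ((z - p) * (z - mirror a p)) ^ (-e p)) =
      (fun z : ℂ => (z - p) * (z - mirror a p)) ^ (-e p) from rfl, meromorphicOrderAt_zpow (hm p),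
      meromorphicOrderAt_mirror_factor (hA p hp) hq]
    by_cases hqp : q = p
    · subst hqp
      rw [if_pos rfl, if_pos rfl]
      split_ifs
      · rw [mul_comm, WithTop.coe_mul]; rfl
      · rw [mul_one, one_mul]
    · rw [if_neg hqp, if_neg hqp, mul_zero]
  rw [h1, Finset.sum_congr rfl h2, Finset.sum_ite_eq]

lemma analyticAt_mirrorProd {a : ℝ} {A : Finset ℂ} (e : ℂ → ℤ) {q : ℂ}
    (h : ∀ p ∈ A, q ≠ p ∧ q ≠ mirror a p) : AnalyticAt ℂ (mirrorProd a A e) q := by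
  unfold mirrorProd
  refine Finset.analyticAt_fun_prod _ fun p hp => ?_
  have h1 : AnalyticAt ℂ (fun z : ℂ => (z - p) * (z - mirror a p)) q := by fun_prop
  exact h1.fun_zpow (mul_ne_zero (sub_ne_zero.2 (h p hp).1) (sub_ne_zero.2 (h p hp).2))

lemma zpow_sum_eq_prod_zpow {ι : Type*} {x : ℂ} (hx : x ≠ 0) (A : Finset ι) (e : ι → ℤ) :
    x ^ (∑ p ∈ A, e p) = ∏ p ∈ A, x ^ e p := by
  classical
  induction A using Finset.induction_on with
  | empty => simp
  | insert p A hp ih => rw [Finset.sum_insert hp, Finset.prod_insert hp, zpow_add₀ hx, ih]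

/-- On the line `z - mirror a p = -conj (z - p)`, so each factor is `-|z - p|²` to an integer power,
and the product has a constant sign. -/
lemma exists_mirrorProd_eq_of_re_eq {a : ℝ} (A : Finset ℂ) (e : ℂ → ℤ) {z : ℂ} (hz : z.re = a)
    (hzA : z ∉ A) : ∃ r : ℝ, 0 < r ∧
      ((-1) ^ (∑ p ∈ A, e p) : ℝ) * mirrorProd a A e z = (r : ℂ) := by
  refine ⟨∏ p ∈ A, (Complex.normSq (z - p)) ^ (-e p), Finset.prod_pos fun p hp => ?_, ?_⟩
  · exact zpow_pos (Complex.normSq_pos.2 (sub_ne_zero.2 (fun h : z = p => hzA (h ▸ hp)))) _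
  · have h1 : (((-1 : ℝ) ^ (∑ p ∈ A, e p) : ℝ) : ℂ) = ∏ p ∈ A, (-1 : ℂ) ^ (-e p) := by
      push_cast
      rw [zpow_sum_eq_prod_zpow (by norm_num)]
      refine Finset.prod_congr rfl fun p _ => ?_
      rw [zpow_neg, ← inv_zpow]; norm_num
    rw [h1, mirrorProd, ← Finset.prod_mul_distrib, Complex.ofReal_prod]
    refine Finset.prod_congr rfl fun p _ => ?_
    rw [← mul_zpow, Complex.ofReal_zpow]
    congr 1
    rw [Complex.normSq_eq_conj_mul_self]
    have h2 : z - mirror a p = -(starRingEnd ℂ) (z - p) := by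
      conv_lhs => rw [← mirror_eq_self hz]
      simp [mirror]
    rw [h2]; ring

lemma tendsto_sub_div_sub_cobounded (c p : ℂ) :
    Tendsto (fun z : ℂ => (z - c) / (z - p)) (Bornology.cobounded ℂ) (𝓝 1) := by
  have h1 : Tendsto (fun z : ℂ => z - p) (Bornology.cobounded ℂ) (Bornology.cobounded ℂ) :=
    tendsto_sub_const_cobounded p
  have h2 : Tendsto (fun z : ℂ => 1 + (p - c) * (z - p)⁻¹) (Bornology.cobounded ℂ)
      (𝓝 (1 + (p - c) * 0)) :=
    ((tendsto_inv₀_cobounded.comp h1).const_mul _).const_add _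
  rw [mul_zero, add_zero] at h2
  refine h2.congr' ?_
  filter_upwards [Bornology.isBounded_def.1 (Bornology.isBounded_singleton (x := p))] with z hz
  have : z - p ≠ 0 := sub_ne_zero.2 hz
  field_simp
  ring

/-- Each point contributes two linear factors, so the product behaves like `(z - a)` to the power
`-2 ∑ e p`: a positive sum of exponents already gives quadratic decay. -/
lemma tendsto_mirrorProd_mul (a : ℝ) (A : Finset ℂ) (e : ℂ → ℤ) :
    Tendsto (fun z => mirrorProd a A e z * (z - a) ^ (2 * ∑ p ∈ A, e p))
      (Bornology.cobounded ℂ) (𝓝 1) := by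
  have h1 : Tendsto (fun z : ℂ => ∏ p ∈ A,
      ((z - a) / (z - p) * ((z - a) / (z - mirror a p))) ^ (e p)) (Bornology.cobounded ℂ)
      (𝓝 (∏ p ∈ A, ((1 : ℂ) * 1) ^ (e p))) := by
    refine tendsto_finsetProd _ fun p _ => ?_
    exact ((tendsto_sub_div_sub_cobounded _ _).mul (tendsto_sub_div_sub_cobounded _ _)).zpow₀ _
      (Or.inl (by norm_num))
  simp only [mul_one, one_zpow, Finset.prod_const_one] at h1
  refine h1.congr' ?_
  filter_upwards [Bornology.isBounded_def.1 (Bornology.isBounded_singleton (x := (a : ℂ)))] with z hz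
  have hz' : z - a ≠ 0 := sub_ne_zero.2 hz
  have h2 : (z - (a : ℂ)) ^ (2 * ∑ p ∈ A, e p) = ∏ p ∈ A, ((z - a) ^ 2) ^ e p := by
    rw [zpow_mul, zpow_sum_eq_prod_zpow (zpow_ne_zero _ hz')]
    rfl
  rw [mirrorProd, h2, ← Finset.prod_mul_distrib]
  refine Finset.prod_congr rfl fun p _ => ?_
  rw [zpow_neg, ← inv_zpow, ← mul_zpow]
  congr 1
  rw [div_mul_div_comm, div_eq_mul_inv, sq]
  ring

/-! ### Comparing zeros and poles by Cauchy's theorem -/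

/-- A holomorphic function on a closed half-plane which decays quadratically and whose real part
is non-negative on the boundary line has real part zero on that line. -/
lemma re_eq_zero_of_isBigO {a : ℝ} {K : ℂ → ℂ} (hK : ∀ z : ℂ, a ≤ z.re → DifferentiableAt ℂ K z)
    {C ρ : ℝ} (hdecay : ∀ z : ℂ, a ≤ z.re → ρ ≤ ‖z - a‖ → ‖K z‖ ≤ C / ‖z - a‖ ^ 2)
    (hre : ∀ z : ℂ, z.re = a → 0 ≤ (K z).re) {t : ℝ} : (K (a + t * Complex.I)).re = 0 := by
  have hline : Continuous fun y : ℝ => (K (a + y * Complex.I)).re := by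
    refine Complex.continuous_re.comp (continuous_iff_continuousAt.2 fun y => ?_)
    have h1 : ContinuousAt K (a + y * Complex.I) := (hK _ (by simp)).continuousAt
    exact h1.comp (f := fun y : ℝ => (a + y * Complex.I : ℂ)) (by fun_prop)
  have hC : 0 ≤ C := by
    have h1 := hdecay ((a + (|ρ| + 1) : ℝ) : ℂ) (by simp; positivity)
      (by simp only [Complex.ofReal_add, add_sub_cancel_left]
          rw [← Complex.ofReal_add, Complex.norm_of_nonneg (by positivity)]
          linarith [le_abs_self ρ])
    by_contra hneg
    push Not at hneg
    have h2 := (norm_nonneg _).trans h1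
    have h3 : 0 < ‖((a + (|ρ| + 1) : ℝ) : ℂ) - a‖ ^ 2 := by
      simp only [Complex.ofReal_add, add_sub_cancel_left]
      rw [← Complex.ofReal_add, Complex.norm_of_nonneg (by positivity)]
      positivity
    exact absurd h2 (not_le.2 (div_neg_of_neg_of_pos hneg h3))
  -- Cauchy's theorem on the rectangle `[a, a + X] × [-X, X]`: the three other sides have total
  -- length `4X`, and `‖K‖ ≤ C / X²` on them.
  have hint : ∀ X : ℝ, max 1 ρ ≤ X →
      ∫ y in (-X)..X, (K (a + y * Complex.I)).re ≤ 4 * C / X := by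
    intro X hX
    have hX1 : 1 ≤ X := (le_max_left _ _).trans hX
    have hXρ : ρ ≤ X := (le_max_right _ _).trans hX
    have hX0 : 0 < X := by linarith
    have hb : ∀ z : ℂ, a ≤ z.re → X ≤ ‖z - a‖ → ‖K z‖ ≤ C / X ^ 2 := by
      intro z hz hzX
      refine (hdecay z hz (hXρ.trans hzX)).trans ?_
      gcongr
    have hrect := Complex.integral_boundary_rect_eq_zero_of_differentiableOn K
      (a - X * Complex.I) (a + X + X * Complex.I) ?_
    swap
    · intro z hz
      rw [Complex.mem_reProdIm] at hz
      refine (hK z ?_).differentiableWithinAt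
      have h1 := hz.1
      simp only [Complex.sub_re, Complex.ofReal_re, Complex.mul_re, Complex.I_re, mul_zero,
        Complex.ofReal_im, Complex.I_im, mul_one, sub_self, sub_zero, Complex.add_re,
        add_zero] at h1
      rw [Set.uIcc_of_le (by linarith)] at h1
      exact h1.1
    simp only [Complex.sub_re, Complex.ofReal_re, Complex.mul_re, Complex.I_re, mul_zero,
        Complex.ofReal_im, Complex.I_im, mul_one, sub_self, sub_zero, Complex.add_re,
        add_zero, Complex.sub_im, Complex.mul_im, zero_add, Complex.add_im, zero_sub,
        Complex.ofReal_neg, Complex.ofReal_add] at hrect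
    set I1 := ∫ x in a..(a + X), K (x + -X * Complex.I)
    set I2 := ∫ x in a..(a + X), K (x + X * Complex.I)
    set I3 := ∫ y in (-X)..X, K (a + X + y * Complex.I)
    set I4 := ∫ y in (-X)..X, K (a + y * Complex.I) with hI4
    have h1 : ‖I1‖ ≤ C / X ^ 2 * |a + X - a| := by
      refine intervalIntegral.norm_integral_le_of_norm_le_const fun x hx => ?_
      rw [Set.uIoc_of_le (by linarith)] at hx
      refine hb _ (by simpa using hx.1.le) ?_
      refine le_trans ?_ (Complex.abs_im_le_norm _)
      simp [abs_of_pos hX0]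
    have h2 : ‖I2‖ ≤ C / X ^ 2 * |a + X - a| := by
      refine intervalIntegral.norm_integral_le_of_norm_le_const fun x hx => ?_
      rw [Set.uIoc_of_le (by linarith)] at hx
      refine hb _ (by simpa using hx.1.le) ?_
      refine le_trans ?_ (Complex.abs_im_le_norm _)
      simp [abs_of_pos hX0]
    have h3 : ‖I3‖ ≤ C / X ^ 2 * |X - -X| := by
      refine intervalIntegral.norm_integral_le_of_norm_le_const fun x hx => ?_
      refine hb _ (by simpa using hX0.le) ?_
      refine le_trans ?_ (Complex.abs_re_le_norm _)
      simp [abs_of_pos hX0]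
    have h4 : ‖I4‖ ≤ 4 * C / X := by
      have h5 : Complex.I * I4 = I1 - I2 + Complex.I * I3 := by
        simp only [smul_eq_mul] at hrect
        linear_combination -hrect
      have h6 : ‖I4‖ = ‖I1 - I2 + Complex.I * I3‖ := by rw [← h5]; simp
      rw [h6]
      calc ‖I1 - I2 + Complex.I * I3‖ ≤ ‖I1‖ + ‖I2‖ + ‖I3‖ := by
            refine (norm_add_le _ _).trans ?_
            gcongr
            · exact norm_sub_le _ _
            · simp
        _ ≤ C / X ^ 2 * X + C / X ^ 2 * X + C / X ^ 2 * (2 * X) := by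
            rw [show a + X - a = X by ring, abs_of_pos hX0] at h1 h2
            rw [show X - -X = 2 * X by ring, abs_of_pos (by positivity)] at h3
            gcongr
        _ = 4 * C / X := by field_simp; ring
    have h7 : ∫ y in (-X)..X, (K (a + y * Complex.I)).re = I4.re := by
      rw [hI4]
      have hcont : Continuous fun y : ℝ => K (a + y * Complex.I) := by
        refine continuous_iff_continuousAt.2 fun y => ?_
        have h1 : ContinuousAt K (a + y * Complex.I) := (hK _ (by simp)).continuousAt
        exact h1.comp (f := fun y : ℝ => (a + y * Complex.I : ℂ)) (by fun_prop)
      exact Complex.reCLM.intervalIntegral_comp_comm (hcont.intervalIntegrable _ _)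
    rw [h7]
    exact (Complex.re_le_norm _).trans h4
  have hnn : ∀ y : ℝ, 0 ≤ (K (a + y * Complex.I)).re := fun y => hre _ (by simp)
  by_contra hne
  have hpos : 0 < (K (a + t * Complex.I)).re := lt_of_le_of_ne (hnn t) (Ne.symm hne)
  set X₀ := max (max 1 ρ) (|t| + 1) with hX₀
  have ht : |t| < X₀ := lt_of_lt_of_le (by linarith) (le_max_right _ _)
  have hX₀pos : 0 < X₀ := (abs_nonneg t).trans_lt ht
  set J := ∫ y in (-X₀)..X₀, (K (a + y * Complex.I)).re with hJ
  have hJpos : 0 < J := by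
    refine intervalIntegral.integral_pos (by linarith) hline.continuousOn
      (fun y _ => hnn y) ⟨t, ?_, hpos⟩
    rw [abs_lt] at ht
    exact ⟨ht.1.le, ht.2.le⟩
  -- The integrand is non-negative, so a fixed window is dominated by every larger one, whose
  -- integral tends to 0.
  have hJle : ∀ X, X₀ ≤ X → J ≤ 4 * C / X := by
    intro X hX
    refine le_trans ?_ (hint X ((le_max_left _ _).trans hX))
    refine intervalIntegral.integral_mono_interval (by linarith) (by linarith) hX
      (Eventually.of_forall hnn) (hline.intervalIntegrable _ _)
  have hlim : Tendsto (fun X : ℝ => 4 * C / X) atTop (𝓝 0) :=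
    tendsto_const_nhds.div_atTop tendsto_id
  have := ge_of_tendsto hlim ((eventually_ge_atTop X₀).mono fun X hX => hJle X hX)
  linarith

lemma eventually_nhdsNE_line_notMem (a t : ℝ) (A : Finset ℂ) :
    ∀ᶠ y : ℝ in 𝓝[≠] t, (a + y * Complex.I : ℂ) ∉ A := by
  have h1 : ∀ p ∈ A, ∀ᶠ y : ℝ in 𝓝[≠] t, (a + y * Complex.I : ℂ) ≠ p := by
    intro p _
    by_cases hp : p.im = t
    · filter_upwards [self_mem_nhdsWithin] with y hy h
      apply hy
      rw [Set.mem_singleton_iff, ← hp, ← h]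
      simp
    · filter_upwards [nhdsWithin_le_nhds (isOpen_ne.mem_nhds (Ne.symm hp))] with y hy h
      apply hy
      rw [← h]
      simp
  filter_upwards [(Finset.eventually_all A).2 h1] with y hy hA
  exact hy _ hA rfl

/-- A meromorphic function `W` which is bounded near infinity in the half-plane `Re s ≥ a` and
has non-negative real part on the line `Re s = a` has at most as many zeros as poles in
`Re s > a`, where a zero of order `m` on the line contributes `m / 2`. -/
theorem sum_exponents_nonpos {a : ℝ} {W : ℂ → ℂ} (hW : Meromorphic W)
    (hbd : ∃ M ρ : ℝ, ∀ z : ℂ, a ≤ z.re → ρ ≤ ‖z - a‖ → AnalyticAt ℂ W z ∧ ‖W z‖ ≤ M)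
    (hline : ∀ z : ℂ, z.re = a → AnalyticAt ℂ W z ∧ 0 ≤ (W z).re)
    (hpos : {z : ℂ | z.re = a ∧ 0 < (W z).re}.Infinite)
    (A : Finset ℂ) (hA : ∀ p ∈ A, a ≤ p.re) (e : ℂ → ℤ)
    (hord : ∀ p ∈ A, (((if p.re = a then 2 else 1) * e p : ℤ) : WithTop ℤ) ≤
      meromorphicOrderAt W p)
    (hord' : ∀ z : ℂ, a ≤ z.re → z ∉ A → 0 ≤ meromorphicOrderAt W z) :
    ∑ p ∈ A, e p ≤ 0 := by
  by_contra! hN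
  obtain ⟨M, ρ, hbd⟩ := hbd
  set R := mirrorProd a A e with hR
  set c : ℝ := (-1) ^ (∑ p ∈ A, e p) with hc
  have hRm : Meromorphic R := meromorphicAt_mirrorProd a A e
  have hWR : MeromorphicOn (W * R) Set.univ := fun z _ => (hW z).mul (hRm z)
  -- The raw product has arbitrary values at the cancelled zeros and poles; in normal form,
  -- non-negative order means analytic.
  set K₀ := toMeromorphicNFOn (W * R) Set.univ with hK₀
  have hK₀an : ∀ z : ℂ, a ≤ z.re → AnalyticAt ℂ K₀ z := by
    intro z hz
    have hNF : MeromorphicNFAt K₀ z := meromorphicNFOn_toMeromorphicNFOn (W * R) Set.univ trivial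
    rw [← hNF.meromorphicOrderAt_nonneg_iff_analyticAt, hK₀,
      meromorphicOrderAt_toMeromorphicNFOn hWR trivial, meromorphicOrderAt_mul (hW z) (hRm z), hR,
      meromorphicOrderAt_mirrorProd hA e hz]
    by_cases hzA : z ∈ A
    · rw [if_pos hzA]
      calc (0 : WithTop ℤ) = (((if z.re = a then 2 else 1) * e z : ℤ) : WithTop ℤ) +
            (((if z.re = a then 2 else 1) * -e z : ℤ) : WithTop ℤ) := by
            rw [← WithTop.coe_add]
            norm_num
        _ ≤ _ := by gcongr; exact hord z hzA
    · rw [if_neg hzA, add_zero]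
      exact hord' z hz hzA
  have hK₀eq : ∀ z : ℂ, a ≤ z.re → z ∉ A → AnalyticAt ℂ W z → K₀ z = W z * R z := by
    intro z hz hzA hWz
    have hRz : AnalyticAt ℂ R z := by
      refine analyticAt_mirrorProd e fun p hp => ⟨fun h => hzA (h ▸ hp), fun h => hzA ?_⟩
      exact ((mirror_eq_iff (hA p hp) hz).1 h).1 ▸ hp
    rw [hK₀, toMeromorphicNFOn_eq_toMeromorphicNFAt hWR trivial,
      toMeromorphicNFAt_eq_self.2 (hWz.mul hRz).meromorphicNFAt, Pi.mul_apply]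
  have hlineEq : ∀ z : ℂ, z.re = a → z ∉ A → ∃ r : ℝ, 0 < r ∧
      (c * K₀ z).re = r * (W z).re := by
    intro z hz hzA
    obtain ⟨r, hr, hrz⟩ := exists_mirrorProd_eq_of_re_eq A e hz hzA
    refine ⟨r, hr, ?_⟩
    rw [hK₀eq z hz.ge hzA (hline z hz).1, mul_left_comm, hrz, mul_comm, Complex.re_ofReal_mul]
  obtain ⟨r, hr⟩ : ∃ r : ℝ, ∀ z : ℂ, r ≤ ‖z‖ →
      ‖R z * (z - a) ^ (2 * ∑ p ∈ A, e p)‖ ≤ 2 ∧ z ∉ A := by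
    have h1 : ∀ᶠ z in Bornology.cobounded ℂ, ‖R z * (z - a) ^ (2 * ∑ p ∈ A, e p)‖ ≤ 2 := by
      have h2 := (tendsto_mirrorProd_mul a A e).norm
      rw [norm_one] at h2
      exact (h2.eventually_lt_const (by norm_num : (1 : ℝ) < 2)).mono fun z hz => hz.le
    have h2 : ∀ᶠ z in Bornology.cobounded ℂ, z ∉ A :=
      Bornology.isBounded_def.1 (A.finite_toSet.isBounded)
    obtain ⟨r, -, hr⟩ := hasBasis_cobounded_norm.eventually_iff.1 (h1.and h2)
    exact ⟨r, fun z hz => hr hz⟩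
  have hKd : ∀ z : ℂ, a ≤ z.re → DifferentiableAt ℂ (fun z => c * K₀ z) z := fun z hz =>
    (hK₀an z hz).differentiableAt.const_mul _
  have hcn : ‖(c : ℂ)‖ = 1 := by
    rw [hc, Complex.ofReal_zpow, norm_zpow]
    simp
  have hdecay : ∀ z : ℂ, a ≤ z.re → max (max ρ 1) (|r| + |a|) ≤ ‖z - a‖ →
      ‖c * K₀ z‖ ≤ (2 * M) / ‖z - a‖ ^ 2 := by
    intro z hz hzr
    have h1 : ρ ≤ ‖z - a‖ := (le_max_left _ _).trans ((le_max_left _ _).trans hzr)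
    have h2 : 1 ≤ ‖z - a‖ := (le_max_right _ _).trans ((le_max_left _ _).trans hzr)
    have h3 : |r| + |a| ≤ ‖z - a‖ := (le_max_right _ _).trans hzr
    have h4 : r ≤ ‖z‖ := by
      have h5 := norm_sub_le z (a : ℂ)
      rw [Complex.norm_real, Real.norm_eq_abs] at h5
      linarith [le_abs_self r]
    obtain ⟨h6, h7⟩ := hr z h4
    obtain ⟨h8, h9⟩ := hbd z hz h1
    have hM : 0 ≤ M := (norm_nonneg _).trans h9
    rw [norm_mul, hcn, one_mul, hK₀eq z hz h7 h8, norm_mul, le_div_iff₀ (by positivity)]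
    rw [norm_mul, norm_zpow] at h6
    -- The sum of the exponents is a positive integer by the assumption for contradiction.
    have h10 : ‖z - a‖ ^ 2 ≤ ‖z - a‖ ^ (2 * ∑ p ∈ A, e p) := by
      rw [← zpow_natCast]
      exact zpow_le_zpow_right₀ h2 (by push_cast; linarith)
    calc ‖W z‖ * ‖R z‖ * ‖z - a‖ ^ 2 ≤ M * ‖R z‖ * ‖z - a‖ ^ (2 * ∑ p ∈ A, e p) := by gcongr
      _ = M * (‖R z‖ * ‖z - a‖ ^ (2 * ∑ p ∈ A, e p)) := by ring
      _ ≤ M * 2 := by gcongr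
      _ = 2 * M := by ring
  have hre : ∀ z : ℂ, z.re = a → 0 ≤ (c * K₀ z).re := by
    intro z hz
    have hzeq : (a + z.im * Complex.I : ℂ) = z := by rw [← hz]; exact Complex.re_add_im z
    have hcont : ContinuousAt (fun y : ℝ => (c * K₀ (a + y * Complex.I)).re) z.im := by
      have h1 : ContinuousAt (fun z => c * K₀ z) (a + z.im * Complex.I) :=
        (hKd _ (by simp)).continuousAt
      exact Complex.continuous_re.continuousAt.comp
        (h1.comp (f := fun y : ℝ => (a + y * Complex.I : ℂ)) (by fun_prop))
    -- The product formula may fail at points of `A` on the line; there the sign is the limit of the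
    -- signs at nearby points of the line.
    have hlim := hcont.continuousWithinAt (s := {z.im}ᶜ)
    have h2 := ge_of_tendsto hlim (b := 0) (by
      filter_upwards [eventually_nhdsNE_line_notMem a z.im A] with y hy
      obtain ⟨r, hr, hrz⟩ := hlineEq (a + y * Complex.I) (by simp) hy
      rw [hrz]
      exact mul_nonneg hr.le (hline _ (by simp)).2)
    simp only [hzeq] at h2
    exact h2
  obtain ⟨z, hz, hzA⟩ := (hpos.sdiff A.finite_toSet).nonempty
  obtain ⟨r, hr, hrz⟩ := hlineEq z hz.1 hzA
  have hzero := re_eq_zero_of_isBigO hKd hdecay hre (t := z.im)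
  rw [show (a + z.im * Complex.I : ℂ) = z by rw [← hz.1]; exact Complex.re_add_im z, hrz] at hzero
  exact absurd hzero (mul_pos hr hz.2).ne'

/-! ### The regularized quotient -/

/-- The quotient `F`, with its removable singularities removed. -/
noncomputable def regQuotient (a : ℝ) (h : ℂ → ℂ) : ℂ → ℂ :=
  toMeromorphicNFOn (symQuotient a h) Set.univ

section

variable {a : ℝ} {h : ℂ → ℂ}

lemma tendsto_line_nhdsNE (a t : ℝ) :
    Tendsto (fun y : ℝ => (a + y * Complex.I : ℂ)) (𝓝[≠] t) (𝓝[≠] (a + t * Complex.I)) := by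
  have h1 : ContinuousAt (fun y : ℝ => (a + y * Complex.I : ℂ)) t := by fun_prop
  refine h1.continuousWithinAt.tendsto_nhdsWithin fun y hy h2 => hy ?_
  simpa using congrArg Complex.im h2

lemma meromorphic_reflected (a : ℝ) (hmer : Meromorphic h) : Meromorphic (reflected a h) :=
  fun z => (meromorphicAt_reflected (hmer (mirror a z))).1

lemma meromorphic_symQuotient (a : ℝ) (hmer : Meromorphic h) : Meromorphic (symQuotient a h) :=
  fun z => (meromorphic_reflected a hmer z).div (hmer z)

lemma meromorphicNFAt_regQuotient (a : ℝ) (h : ℂ → ℂ) (z : ℂ) :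
    MeromorphicNFAt (regQuotient a h) z :=
  meromorphicNFOn_toMeromorphicNFOn _ _ trivial

lemma meromorphicOrderAt_regQuotient (a : ℝ) (hmer : Meromorphic h) (z : ℂ) :
    meromorphicOrderAt (regQuotient a h) z =
      meromorphicOrderAt h (mirror a z) + -meromorphicOrderAt h z := by
  have h1 : symQuotient a h = reflected a h * h⁻¹ := by
    ext s; simp [symQuotient, div_eq_mul_inv]
  have hm : MeromorphicOn (symQuotient a h) Set.univ := fun w _ => meromorphic_symQuotient a hmer w
  rw [regQuotient, meromorphicOrderAt_toMeromorphicNFOn hm trivial, h1,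
    meromorphicOrderAt_mul (meromorphic_reflected a hmer z) (hmer z).inv, meromorphicOrderAt_inv,
    (meromorphicAt_reflected (hmer (mirror a z))).2]

lemma regQuotient_eventuallyEq (a : ℝ) (hmer : Meromorphic h) (z : ℂ) :
    ∀ᶠ w in 𝓝[≠] z, regQuotient a h w = symQuotient a h w := by
  filter_upwards [MeromorphicOn.toMeromorphicNFOn_eq_self_on_nhdsNE
    (fun w _ => meromorphic_symQuotient a hmer w) (Set.mem_univ z)] with w hw
  exact hw

lemma AbsLt.regQuotient (hmer : Meromorphic h) {s : ℂ} {r : ℝ}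
    (hlt : AbsLt (symQuotient a h) s r) :
    AnalyticAt ℂ (regQuotient a h) s ∧ ‖regQuotient a h s‖ < r := by
  have hm : MeromorphicOn (symQuotient a h) Set.univ := fun w _ => meromorphic_symQuotient a hmer w
  constructor
  · rw [← (meromorphicNFAt_regQuotient a h s).meromorphicOrderAt_nonneg_iff_analyticAt,
      ZeroCount.regQuotient, meromorphicOrderAt_toMeromorphicNFOn hm trivial]
    exact hlt.1
  · rw [ZeroCount.regQuotient, toMeromorphicNFOn_eq_toMeromorphicNFAt hm trivial]
    exact hlt.2

/-- Identity theorem: `h` has order 0 on the line, so it vanishes identically near no point. -/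
lemma meromorphicOrderAt_ne_top_of_line (hmer : Meromorphic h)
    (hline : ∀ s : ℂ, s.re = a → meromorphicOrderAt h s = 0) (z : ℂ) :
    meromorphicOrderAt h z ≠ ⊤ := by
  refine MeromorphicOn.meromorphicOrderAt_ne_top_of_isPreconnected (U := Set.univ) (x := (a : ℂ))
    (fun w _ => hmer w) isPreconnected_univ trivial trivial ?_
  rw [hline a (Complex.ofReal_re a)]
  exact WithTop.zero_ne_top

lemma analyticAt_regQuotient_line (hmer : Meromorphic h)
    (hline : ∀ s : ℂ, s.re = a → meromorphicOrderAt h s = 0) {s : ℂ} (hs : s.re = a) :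
    AnalyticAt ℂ (regQuotient a h) s := by
  rw [← (meromorphicNFAt_regQuotient a h s).meromorphicOrderAt_nonneg_iff_analyticAt,
    meromorphicOrderAt_regQuotient a hmer, mirror_eq_self hs, hline s hs]
  simp

/-- At nearby points of the line where `h ≠ 0`, the quotient is `conj (h w) / h w`. Passing to the
limit avoids the value of `h` at `s`, which the order does not control. -/
lemma norm_regQuotient_line (hmer : Meromorphic h)
    (hline : ∀ s : ℂ, s.re = a → meromorphicOrderAt h s = 0) {s : ℂ} (hs : s.re = a) :
    ‖regQuotient a h s‖ = 1 := by
  have hseq : (a + s.im * Complex.I : ℂ) = s := by rw [← hs]; exact Complex.re_add_im s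
  have h0 : ∀ᶠ w in 𝓝[≠] s, h w ≠ 0 :=
    (meromorphicOrderAt_ne_top_iff_eventually_ne_zero (hmer s)).1
      (meromorphicOrderAt_ne_top_of_line hmer hline s)
  have h1 := (regQuotient_eventuallyEq a hmer s).and h0
  rw [← hseq] at h1
  have h2 := (tendsto_line_nhdsNE a s.im).eventually h1
  have h3 : Tendsto (fun y : ℝ => ‖regQuotient a h (a + y * Complex.I)‖) (𝓝[≠] s.im)
      (𝓝 ‖regQuotient a h (a + s.im * Complex.I)‖) := by
    have h4 : ContinuousAt (regQuotient a h) (a + s.im * Complex.I) := by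
      rw [hseq]
      exact (analyticAt_regQuotient_line hmer hline hs).continuousAt
    exact (h4.tendsto.mono_left nhdsWithin_le_nhds).norm.comp (tendsto_line_nhdsNE a s.im)
  rw [hseq] at h3
  refine tendsto_nhds_unique h3 (tendsto_const_nhds.congr' ?_)
  filter_upwards [h2] with y hy
  rw [hy.1, symQuotient, reflected_eq, mirror_eq_self (by simp), norm_div, RCLike.norm_conj,
    div_self (norm_ne_zero_iff.2 hy.2)]

/-- A pole of `F` comes from a zero of `h` at the point or a pole of `h` at its mirror image; the
line itself has none. -/
lemma finite_poles_regQuotient (hmer : Meromorphic h)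
    (hline : ∀ s : ℂ, s.re = a → meromorphicOrderAt h s = 0)
    (hpoles : (polesIn h Set.univ).Finite) (hzeros : (zerosIn h (rightHalfPlane a)).Finite) :
    {z : ℂ | a ≤ z.re ∧ meromorphicOrderAt (regQuotient a h) z < 0}.Finite := by
  refine (hzeros.union (hpoles.image (mirror a))).subset fun z hz => ?_
  obtain ⟨hza, hz⟩ := hz
  rw [meromorphicOrderAt_regQuotient a hmer] at hz
  have hza' : a < z.re := by
    refine lt_of_le_of_ne hza fun heq => ?_
    rw [mirror_eq_self heq.symm, hline z heq.symm] at hz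
    simp at hz
  by_cases h1 : meromorphicOrderAt h (mirror a z) < 0
  · exact Or.inr ⟨mirror a z, ⟨trivial, h1⟩, mirror_mirror a z⟩
  · refine Or.inl ⟨hza', ?_⟩
    by_contra h2
    push Not at h1 h2
    lift meromorphicOrderAt h (mirror a z) to ℤ using
      meromorphicOrderAt_ne_top_of_line hmer hline _ with m
    lift meromorphicOrderAt h z to ℤ using
      meromorphicOrderAt_ne_top_of_line hmer hline _ with n
    norm_cast at h1 h2 hz
    omega

lemma exists_bound_regQuotient (hmer : Meromorphic h)
    (hpoles : (polesIn h Set.univ).Finite)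
    (hzeros : (zerosIn h (rightHalfPlane a)).Finite)
    (hline : ∀ s : ℂ, s.re = a → meromorphicOrderAt h s = 0)
    (hi : ∀ η : ℝ, 0 < η → ∃ σ₀ : ℝ, a < σ₀ ∧ ∀ s : ℂ, σ₀ ≤ s.re →
      AbsLt (symQuotient a h) s η)
    (hii : ∀ ε : ℝ, 0 < ε → ∀ σ₀ : ℝ, a < σ₀ → ∃ T T' : ℕ → ℝ,
      Tendsto T atTop atTop ∧ Tendsto T' atTop atTop ∧
      ∀ n : ℕ, ∀ s : ℂ, a ≤ s.re → s.re ≤ σ₀ → (s.im = T n ∨ s.im = -T' n) →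
        AbsLt (symQuotient a h) s (Real.exp (ε * ‖s‖))) :
    ∃ M ρ : ℝ, ∀ z : ℂ, a ≤ z.re → ρ ≤ ‖z - a‖ →
      AnalyticAt ℂ (regQuotient a h) z ∧ ‖regQuotient a h z‖ ≤ M := by
  -- With `η = 1`, `|F| ≤ 1` on both vertical sides of the strip `a ≤ Re z ≤ b` and everywhere to
  -- its right.
  obtain ⟨b, hab, hb⟩ := hi 1 one_pos
  have hfin := finite_poles_regQuotient hmer hline hpoles hzeros
  obtain ⟨t₁, ht₁⟩ := (hfin.image fun z => |z.im|).bddAbove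
  set t₀ := max t₁ 0 + 1 with ht₀
  have ht₀1 : t₁ < t₀ := by linarith [le_max_left t₁ 0]
  have ht₀0 : 0 < t₀ := by linarith [le_max_right t₁ 0]
  have han : ∀ z : ℂ, a ≤ z.re → t₀ ≤ |z.im| → AnalyticAt ℂ (regQuotient a h) z := by
    intro z hz hzt
    rw [← (meromorphicNFAt_regQuotient a h z).meromorphicOrderAt_nonneg_iff_analyticAt]
    by_contra! hneg
    have h1 : |z.im| ≤ t₁ := ht₁ ⟨z, ⟨hz, hneg⟩, rfl⟩
    linarith
  have hside : ∀ z : ℂ, z.re = a ∨ z.re = b → ‖regQuotient a h z‖ ≤ 1 := by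
    rintro z (hz | hz)
    · exact (norm_regQuotient_line hmer hline hz).le
    · exact ((hb z hz.ge).regQuotient hmer).2.le
  obtain ⟨M₁, hM₁⟩ := exists_bound_upper_half_strip (t₀ := t₀) hab
    (fun z h1 _ h3 => (han z h1 (h3.trans (le_abs_self _))).differentiableAt)
    (fun z hz _ => hside z hz) (fun ε hε => by
      obtain ⟨T, T', hT, -, hTT⟩ := hii ε hε b hab
      exact ⟨T, hT, fun n z h1 h2 h3 => ((hTT n z h1 h2 (Or.inl h3)).regQuotient hmer).2.le⟩)
  obtain ⟨M₂, hM₂⟩ := exists_bound_lower_half_strip (t₀ := t₀) hab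
    (fun z h1 _ h3 => (han z h1 (by linarith [neg_le_abs z.im])).differentiableAt)
    (fun z hz _ => hside z hz) (fun ε hε => by
      obtain ⟨T, T', -, hT', hTT⟩ := hii ε hε b hab
      exact ⟨T', hT', fun n z h1 h2 h3 => ((hTT n z h1 h2 (Or.inr h3)).regQuotient hmer).2.le⟩)
  -- Within the strip, this radius forces `|Im z| ≥ t₀`, beyond all poles.
  refine ⟨max 1 (max M₁ M₂), (b - a) + t₀, fun z hz hzρ => ?_⟩
  rcases le_total b z.re with hbz | hbz
  · have h1 := (hb z hbz).regQuotient hmer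
    exact ⟨h1.1, h1.2.le.trans (le_max_left _ _)⟩
  · have h1 := Complex.norm_le_abs_re_add_abs_im (z - a)
    simp only [Complex.sub_re, Complex.ofReal_re, Complex.sub_im, Complex.ofReal_im,
      sub_zero] at h1
    rw [abs_of_nonneg (by linarith)] at h1
    have h2 : t₀ ≤ |z.im| := by linarith
    refine ⟨han z hz h2, ?_⟩
    rcases le_abs.1 h2 with h3 | h3
    · exact (hM₁ z hz hbz h3).trans ((le_max_left _ _).trans (le_max_right _ _))
    · exact (hM₂ z hz hbz (by linarith)).trans ((le_max_right _ _).trans (le_max_right _ _))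

/-! ### The factor `1 ± F` and the symmetry of `f` -/

/-- The factor `1 ± F` of `f = h (1 ± F)`, with its removable singularities removed. -/
noncomputable def cofactor (a : ℝ) (sgn : ℂ) (h : ℂ → ℂ) : ℂ → ℂ := fun z =>
  1 + sgn * regQuotient a h z

lemma analyticAt_cofactor {sgn : ℂ} {z : ℂ} (hz : AnalyticAt ℂ (regQuotient a h) z) :
    AnalyticAt ℂ (cofactor a sgn h) z :=
  analyticAt_const.add (analyticAt_const.mul hz)

lemma meromorphic_cofactor (a : ℝ) (sgn : ℂ) (h : ℂ → ℂ) : Meromorphic (cofactor a sgn h) :=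
  fun z => (MeromorphicAt.const 1 z).add
    ((MeromorphicAt.const sgn z).mul (meromorphicNFAt_regQuotient a h z).meromorphicAt)

lemma finite_poles_cofactor (sgn : ℂ) (hmer : Meromorphic h)
    (hline : ∀ s : ℂ, s.re = a → meromorphicOrderAt h s = 0)
    (hpoles : (polesIn h Set.univ).Finite) (hzeros : (zerosIn h (rightHalfPlane a)).Finite) :
    {z : ℂ | a ≤ z.re ∧ meromorphicOrderAt (cofactor a sgn h) z < 0}.Finite := by
  refine (finite_poles_regQuotient hmer hline hpoles hzeros).subset fun z hz => ⟨hz.1, ?_⟩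
  by_contra! hneg
  rw [(meromorphicNFAt_regQuotient a h z).meromorphicOrderAt_nonneg_iff_analyticAt] at hneg
  exact absurd hz.2 (not_lt.2 (analyticAt_cofactor hneg).meromorphicOrderAt_nonneg)

/-- Far to the right `|F| < 1`, so `1 ± F` is nonzero at one point; the identity theorem does the
rest. -/
lemma meromorphicOrderAt_cofactor_ne_top {sgn : ℂ} (hsgn : ‖sgn‖ = 1) (hmer : Meromorphic h)
    (hi : ∀ η : ℝ, 0 < η → ∃ σ₀ : ℝ, a < σ₀ ∧ ∀ s : ℂ, σ₀ ≤ s.re →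
      AbsLt (symQuotient a h) s η) (z : ℂ) :
    meromorphicOrderAt (cofactor a sgn h) z ≠ ⊤ := by
  obtain ⟨b, hab, hb⟩ := hi 1 one_pos
  obtain ⟨h1, h2⟩ := (hb b (by simp)).regQuotient hmer
  refine MeromorphicOn.meromorphicOrderAt_ne_top_of_isPreconnected (U := Set.univ) (x := (b : ℂ))
    (fun w _ => meromorphic_cofactor a sgn h w) isPreconnected_univ trivial trivial ?_
  have h3 : cofactor a sgn h b ≠ 0 := by
    intro h0
    have h4 : sgn * regQuotient a h b = -1 := by
      rw [cofactor] at h0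
      linear_combination h0
    have h5 := congrArg norm h4
    rw [norm_mul, hsgn, one_mul, norm_neg, norm_one] at h5
    linarith
  rw [(analyticAt_cofactor h1).meromorphicNFAt.meromorphicOrderAt_eq_zero_iff.2 h3]
  exact WithTop.zero_ne_top

/-- For `|w| = 1`, `1 + w` has non-negative real part, and zero real part only when `w = -1`. -/
lemma cofactor_line {sgn : ℂ} (hsgn : ‖sgn‖ = 1) (hmer : Meromorphic h)
    (hline : ∀ s : ℂ, s.re = a → meromorphicOrderAt h s = 0) {s : ℂ} (hs : s.re = a) :
    0 ≤ (cofactor a sgn h s).re ∧ ((cofactor a sgn h s).re ≤ 0 → cofactor a sgn h s = 0) := by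
  have hn : ‖sgn * regQuotient a h s‖ = 1 := by
    rw [norm_mul, hsgn, norm_regQuotient_line hmer hline hs, one_mul]
  simp only [cofactor, Complex.add_re, Complex.one_re]
  set w := sgn * regQuotient a h s
  have h1 := Complex.abs_re_le_norm w
  rw [hn] at h1
  refine ⟨by linarith [neg_le_of_abs_le h1], fun h2 => ?_⟩
  have h3 : w.re = -1 := by linarith [neg_le_of_abs_le h1]
  have h4 : w.re * w.re + w.im * w.im = 1 := by
    rw [← Complex.normSq_apply, Complex.normSq_eq_norm_sq, hn, one_pow]
  have h5 : w.im = 0 := by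
    rw [h3] at h4
    exact mul_self_eq_zero.1 (by linarith)
  apply Complex.ext <;> simp [h3, h5]

/-- Zeros of the cofactor are isolated, and elsewhere on the line its real part is positive. -/
lemma infinite_pos_cofactor {sgn : ℂ} (hsgn : ‖sgn‖ = 1) (hmer : Meromorphic h)
    (hline : ∀ s : ℂ, s.re = a → meromorphicOrderAt h s = 0)
    (hi : ∀ η : ℝ, 0 < η → ∃ σ₀ : ℝ, a < σ₀ ∧ ∀ s : ℂ, σ₀ ≤ s.re →
      AbsLt (symQuotient a h) s η) :
    {z : ℂ | z.re = a ∧ 0 < (cofactor a sgn h z).re}.Infinite := by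
  intro hfin
  have h1 : ∀ᶠ w in 𝓝[≠] (a + (0 : ℝ) * Complex.I : ℂ), cofactor a sgn h w ≠ 0 :=
    (meromorphicOrderAt_ne_top_iff_eventually_ne_zero (meromorphic_cofactor a sgn h _)).1
      (meromorphicOrderAt_cofactor_ne_top hsgn hmer hi _)
  have h2 := (tendsto_line_nhdsNE a 0).eventually h1
  obtain ⟨y, hy1, hy2⟩ := (h2.and (eventually_nhdsNE_line_notMem a 0 hfin.toFinset)).exists
  refine hy1 ((cofactor_line hsgn hmer hline (by simp)).2 ?_)
  by_contra! hpos
  exact hy2 (hfin.mem_toFinset.2 ⟨by simp, hpos⟩)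

lemma meromorphicOrderAt_symmetrized {sgn : ℂ} (hmer : Meromorphic h)
    (hline : ∀ s : ℂ, s.re = a → meromorphicOrderAt h s = 0) (z : ℂ) :
    meromorphicOrderAt (symmetrized a sgn h) z =
      meromorphicOrderAt h z + meromorphicOrderAt (cofactor a sgn h) z := by
  rw [← meromorphicOrderAt_mul (hmer z) (meromorphic_cofactor a sgn h z)]
  refine meromorphicOrderAt_congr ?_
  filter_upwards [regQuotient_eventuallyEq a hmer z,
    (meromorphicOrderAt_ne_top_iff_eventually_ne_zero (hmer z)).1
      (meromorphicOrderAt_ne_top_of_line hmer hline z)] with w h1 h2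
  rw [Pi.mul_apply, cofactor, h1, symmetrized, symQuotient]
  field_simp

lemma reflected_symmetrized {sgn : ℂ} (hsgn : sgn = 1 ∨ sgn = -1) (s : ℂ) :
    reflected a (symmetrized a sgn h) s = sgn * symmetrized a sgn h s := by
  simp only [reflected_eq, symmetrized, map_add, map_mul, mirror_mirror, Complex.conj_conj]
  rcases hsgn with rfl | rfl
  · simp; ring
  · simp

lemma meromorphic_symmetrized (a : ℝ) (sgn : ℂ) (hmer : Meromorphic h) :
    Meromorphic (symmetrized a sgn h) :=
  fun z => (hmer z).add ((MeromorphicAt.const sgn z).mul (meromorphic_reflected a hmer z))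

lemma meromorphicOrderAt_symmetrized_mirror {sgn : ℂ} (hsgn : sgn = 1 ∨ sgn = -1)
    (hmer : Meromorphic h) (z : ℂ) :
    meromorphicOrderAt (symmetrized a sgn h) (mirror a z) =
      meromorphicOrderAt (symmetrized a sgn h) z := by
  have h0 : sgn ≠ 0 := by rcases hsgn with rfl | rfl <;> norm_num
  rw [← (meromorphicAt_reflected (meromorphic_symmetrized a sgn hmer (mirror a z))).2]
  rw [show reflected a (symmetrized a sgn h) = (fun _ => sgn) * symmetrized a sgn h from
    funext fun s => reflected_symmetrized hsgn s]
  exact meromorphicOrderAt_mul_of_ne_zero analyticAt_const h0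

end

/-! ### Counting with integer orders -/

section

variable {a : ℝ} {oh of ow : ℂ → ℤ}

lemma finite_exceptional_right
    (hadd : ∀ z, of z = oh z + ow z) (hhl : ∀ z : ℂ, z.re = a → oh z = 0)
    (hcore : ∀ A : Finset ℂ, (∀ p ∈ A, a ≤ p.re) → ∀ e : ℂ → ℤ,
      (∀ p ∈ A, (if p.re = a then 2 else 1) * e p ≤ ow p) →
      (∀ z : ℂ, a ≤ z.re → z ∉ A → 0 ≤ ow z) → ∑ p ∈ A, e p ≤ 0)
    (hoh : {z : ℂ | a < z.re ∧ oh z ≠ 0}.Finite) (how : {z : ℂ | a ≤ z.re ∧ ow z < 0}.Finite) :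
    {z : ℂ | a ≤ z.re ∧ 0 < of z ∧ ¬ (z.re = a ∧ of z = 1)}.Finite := by
  classical
  set E := hoh.toFinset ∪ how.toFinset with hE
  have hEa : ∀ p ∈ E, a ≤ p.re := by
    intro p hp
    rcases Finset.mem_union.1 hp with hp | hp
    · exact ((hoh.mem_toFinset).1 hp).1.le
    · exact ((how.mem_toFinset).1 hp).1
  set e : ℂ → ℤ := fun p => if p.re = a then ow p / 2 else ow p with he
  by_contra hinf
  have hinf' := Set.Infinite.sdiff hinf E.finite_toSet
  -- Each point of `Q` contributes at least 1, so this many points make the total over `E ∪ Q`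
  -- positive.
  obtain ⟨Q, hQ, hQc⟩ := hinf'.exists_subset_card_eq ((-∑ p ∈ E, e p).toNat + 1)
  have hdisj : Disjoint E Q := by
    rw [Finset.disjoint_left]
    exact fun p hp hpQ => (hQ hpQ).2 hp
  have hsum := hcore (E ∪ Q) (fun p hp => ?_) e (fun p _ => ?_) (fun z hz hzA => ?_)
  · rw [Finset.sum_union hdisj] at hsum
    have h1 : (Q.card : ℤ) ≤ ∑ p ∈ Q, e p := by
      have h2 : ∀ p ∈ Q, (1 : ℤ) ≤ e p := by
        intro p hp
        obtain ⟨⟨h3, h4, h5⟩, h6⟩ := hQ hp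
        have h7 := hadd p
        simp only [he]
        split_ifs with h8
        · rw [hhl p h8] at h7
          have h9 : of p ≠ 1 := fun h => h5 ⟨h8, h⟩
          omega
        · have h9 : oh p = 0 := by
            by_contra h10
            exact h6 (Finset.mem_union_left _
              (hoh.mem_toFinset.2 ⟨lt_of_le_of_ne h3 (Ne.symm h8), h10⟩))
          omega
      simpa using Finset.sum_le_sum h2
    rw [hQc] at h1
    push_cast at h1
    have h3 := Int.self_le_toNat (-∑ p ∈ E, e p)
    omega
  · rcases Finset.mem_union.1 hp with hp | hp
    · exact hEa p hp
    · exact (hQ hp).1.1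
  · simp only [he]
    split_ifs <;> omega
  · by_contra! hneg
    exact hzA (Finset.mem_union_left _ (Finset.mem_union_right _ (how.mem_toFinset.2 ⟨hz, hneg⟩)))

lemma finite_exceptional (hsym : ∀ z, of (mirror a z) = of z)
    (hfin : {z : ℂ | a ≤ z.re ∧ 0 < of z ∧ ¬ (z.re = a ∧ of z = 1)}.Finite) :
    {z : ℂ | 0 < of z ∧ ¬ (z.re = a ∧ of z = 1)}.Finite := by
  refine (hfin.union (hfin.image (mirror a))).subset fun z hz => ?_
  rcases le_total a z.re with h1 | h1
  · exact Or.inl ⟨h1, hz⟩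
  · refine Or.inr ⟨mirror a z, ⟨by simp; linarith, ?_, fun h2 => hz.2 ⟨?_, ?_⟩⟩, mirror_mirror a z⟩
    · rw [hsym]; exact hz.1
    · have := h2.1
      simp at this
      linarith
    · rw [← hsym]; exact h2.2

/-- Mirror images pair the zeros left and right of the line; this is also why the number off the
line is even. -/
lemma sum_eq_line_add_two_mul_right (hsym : ∀ z, of (mirror a z) = of z) (B : Finset ℂ)
    (hB : ∀ z, z ∈ B ↔ mirror a z ∈ B) :
    ∑ z ∈ B, of z = ∑ z ∈ B with z.re = a, of z + 2 * ∑ z ∈ B with a < z.re, of z := by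
  classical
  have h1 : ∑ z ∈ B with z.re < a, of z = ∑ z ∈ B with a < z.re, of z := by
    refine Finset.sum_nbij' (mirror a) (mirror a) ?_ ?_ ?_ ?_ ?_
    · intro z hz
      rw [Finset.mem_filter] at hz ⊢
      exact ⟨(hB z).1 hz.1, by rw [mirror_re]; linarith [hz.2]⟩
    · intro z hz
      rw [Finset.mem_filter] at hz ⊢
      exact ⟨(hB z).1 hz.1, by rw [mirror_re]; linarith [hz.2]⟩
    · intro z _; exact mirror_mirror a z
    · intro z _; exact mirror_mirror a z
    · intro z _; exact (hsym z).symm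
  rw [two_mul]
  nth_rw 1 [← h1]
  simp only [Finset.sum_filter, ← Finset.sum_add_distrib]
  refine Finset.sum_congr rfl fun z _ => ?_
  rcases lt_trichotomy z.re a with h | h | h
  · rw [if_neg h.ne, if_pos h, if_neg h.not_gt]; ring
  · rw [if_pos h, if_neg (by linarith), if_neg (by linarith)]; ring
  · rw [if_neg h.ne', if_neg h.not_gt, if_pos h]; ring

lemma right_and_line_count_le
    (hadd : ∀ z, of z = oh z + ow z) (hhl : ∀ z : ℂ, z.re = a → oh z = 0)
    (hwl : ∀ z : ℂ, z.re = a → 0 ≤ ow z)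
    (hcore : ∀ A : Finset ℂ, (∀ p ∈ A, a ≤ p.re) → ∀ e : ℂ → ℤ,
      (∀ p ∈ A, (if p.re = a then 2 else 1) * e p ≤ ow p) →
      (∀ z : ℂ, a ≤ z.re → z ∉ A → 0 ≤ ow z) → ∑ p ∈ A, e p ≤ 0)
    (hoh : {z : ℂ | a < z.re ∧ oh z ≠ 0}.Finite) (how : {z : ℂ | a ≤ z.re ∧ ow z < 0}.Finite)
    (B : Finset ℂ) (hB : ∀ z ∈ B, 0 < of z) :
    2 * (∑ z ∈ B with a < z.re, of z) + ∑ z ∈ B with z.re = a, (of z - 1) ≤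
      2 * (∑ᶠ z ∈ {z : ℂ | a < z.re ∧ of z < 0}, -of z)
        + 2 * (∑ᶠ z ∈ {z : ℂ | a < z.re ∧ 0 < oh z}, oh z)
        - 2 * (∑ᶠ z ∈ {z : ℂ | a < z.re ∧ oh z < 0}, -oh z) := by
  classical
  -- `A` contains the supports of all the sums in the statement, so the inequality can be checked
  -- point by point.
  set A := B.filter (fun z => a ≤ z.re) ∪ (hoh.toFinset ∪ how.toFinset) with hA
  have hAa : ∀ p ∈ A, a ≤ p.re := by
    intro p hp
    simp only [hA, Finset.mem_union, Finset.mem_filter, Set.Finite.mem_toFinset,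
      Set.mem_ofPred_eq] at hp
    rcases hp with hp | hp | hp
    exacts [hp.2, hp.1.le, hp.1]
  have hAh : ∀ z : ℂ, a < z.re → oh z ≠ 0 → z ∈ A := fun z h1 h2 =>
    Finset.mem_union_right _ (Finset.mem_union_left _ (hoh.mem_toFinset.2 ⟨h1, h2⟩))
  have hAw : ∀ z : ℂ, a ≤ z.re → ow z < 0 → z ∈ A := fun z h1 h2 =>
    Finset.mem_union_right _ (Finset.mem_union_right _ (how.mem_toFinset.2 ⟨h1, h2⟩))
  set e : ℂ → ℤ := fun p => if p.re = a then ow p / 2 else ow p with he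
  have hsum : ∑ p ∈ A, e p ≤ 0 := by
    refine hcore A hAa e (fun p _ => ?_) (fun z hz hzA => ?_)
    · simp only [he]
      split_ifs <;> omega
    · by_contra! hneg
      exact hzA (hAw z hz hneg)
  have hconv : ∀ (P : ℂ → Prop) (g : ℂ → ℤ), (∀ z, P z → z ∈ A) →
      ∑ᶠ z ∈ {z : ℂ | P z}, g z = ∑ z ∈ A, if P z then g z else 0 := by
    intro P g hP
    rw [← Finset.sum_filter]
    refine finsum_mem_eq_sum_of_inter_support_eq _ ?_
    congr 1
    ext z
    simp only [Set.mem_ofPred_eq, Finset.coe_filter]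
    exact ⟨fun hz => ⟨hP z hz, hz⟩, fun hz => hz.2⟩
  have hBconv : ∀ (P : ℂ → Prop) (g : ℂ → ℤ), (∀ z, P z → a ≤ z.re) →
      ∑ z ∈ B with P z, g z = ∑ z ∈ A, if z ∈ B ∧ P z then g z else 0 := by
    intro P g hP
    rw [← Finset.sum_filter]
    congr 1
    ext z
    simp only [Finset.mem_filter]
    exact ⟨fun hz => ⟨Finset.mem_union_left _ (Finset.mem_filter.2 ⟨hz.1, hP z hz.2⟩), hz⟩,
      fun hz => hz.2⟩
  rw [hBconv _ _ (fun z hz => hz.le), hBconv _ _ (fun z hz => hz.ge),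
    hconv _ _ (fun z hz => ?_), hconv _ _ (fun z hz => hAh z hz.1 hz.2.ne'),
    hconv _ _ (fun z hz => hAh z hz.1 hz.2.ne)]
  -- Off the line this is `of = oh + ow`. On the line `h` has order 0, and rounding down costs at
  -- most 1, exactly the 1 in `of z - 1`.
  · have hterm : ∀ z ∈ A, 2 * (if z ∈ B ∧ a < z.re then of z else 0)
          + (if z ∈ B ∧ z.re = a then of z - 1 else 0) ≤
        2 * (if a < z.re ∧ of z < 0 then -of z else 0)
          + 2 * (if a < z.re ∧ 0 < oh z then oh z else 0)
          - 2 * (if a < z.re ∧ oh z < 0 then -oh z else 0) + 2 * e z := by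
      intro z hz
      have h1 := hadd z
      rcases (hAa z hz).eq_or_lt with h2 | h2
      · have h3 := hhl z h2.symm
        have h4 := hwl z h2.symm
        simp only [he, h2.symm, lt_irrefl, and_false, false_and, if_false, if_true, and_true]
        split_ifs <;> omega
      · have h3 : z.re ≠ a := h2.ne'
        simp only [he, h2, h3, and_false, true_and, if_false, and_true]
        by_cases h4 : z ∈ B
        · have h5 := hB z h4
          simp only [h4, if_true]
          split_ifs <;> omega
        · simp only [h4, if_false]
          split_ifs <;> omega
    have h1 := Finset.sum_le_sum hterm
    simp only [Finset.sum_add_distrib, Finset.sum_sub_distrib, ← Finset.mul_sum] at h1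
    have h2 : 2 * ∑ z ∈ A, e z ≤ 0 := by linarith
    refine le_trans ?_ (add_le_of_nonpos_right h2)
    convert! h1
  · by_cases h1 : ow z < 0
    · exact hAw z hz.1.le h1
    · refine hAh z hz.1 ?_
      have h2 := hadd z
      have h3 := hz.2
      omega

end

/-! ### From orders to counting functions -/

lemma zerosIn_eq {m : ℂ → ℂ} (hm : ∀ z, meromorphicOrderAt m z ≠ ⊤) (S : Set ℂ) :
    zerosIn m S = {z | z ∈ S ∧ 0 < (meromorphicOrderAt m z).untop₀} := by
  ext z
  simp only [zerosIn, Set.mem_ofPred_eq]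
  lift meromorphicOrderAt m z to ℤ using hm z with n
  simp

lemma polesIn_eq {m : ℂ → ℂ} (hm : ∀ z, meromorphicOrderAt m z ≠ ⊤) (S : Set ℂ) :
    polesIn m S = {z | z ∈ S ∧ (meromorphicOrderAt m z).untop₀ < 0} := by
  ext z
  simp only [polesIn, Set.mem_ofPred_eq]
  lift meromorphicOrderAt m z to ℤ using hm z with n
  simp

/-- Simple zeros on the line may be infinite in number, so compactness is needed: a divisor on a
compact set has finite support. -/
lemma finite_zeros_segment {m : ℂ → ℂ} (hmer : Meromorphic m) (a T : ℝ) :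
    {z : ℂ | z ∈ criticalSegment a T ∧ 0 < (meromorphicOrderAt m z).untop₀}.Finite := by
  have hK : IsCompact ({a} ×ℂ Set.Icc (-T) T) := isCompact_singleton.reProdIm isCompact_Icc
  refine ((MeromorphicOn.divisor m ({a} ×ℂ Set.Icc (-T) T)).finiteSupport hK).subset
    fun z hz => ?_
  have hzK : z ∈ {a} ×ℂ Set.Icc (-T) T := by
    rw [Complex.mem_reProdIm]
    exact ⟨hz.1.1, abs_le.1 hz.1.2.le⟩
  rw [Function.mem_support, MeromorphicOn.divisor_apply (fun w _ => hmer w) hzK]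
  exact hz.2.ne'

lemma numZeros_eq_sum {m : ℂ → ℂ} (hm : ∀ z, meromorphicOrderAt m z ≠ ⊤) {S : Set ℂ}
    (B : Finset ℂ) (hB : ∀ z, z ∈ B ↔ z ∈ S ∧ 0 < (meromorphicOrderAt m z).untop₀) :
    numZeros m S = ∑ z ∈ B, (meromorphicOrderAt m z).untop₀ := by
  have h1 : zerosIn m S = (B : Set ℂ) := by
    rw [zerosIn_eq hm]
    ext z
    exact (hB z).symm
  rw [numZeros, h1, finsum_mem_coe_finset]

lemma numDistinctZeros_eq_card {m : ℂ → ℂ} (hm : ∀ z, meromorphicOrderAt m z ≠ ⊤) {S : Set ℂ}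
    (B : Finset ℂ) (hB : ∀ z, z ∈ B ↔ z ∈ S ∧ 0 < (meromorphicOrderAt m z).untop₀) :
    numDistinctZeros m S = B.card := by
  have h1 : zerosIn m S = (B : Set ℂ) := by
    rw [zerosIn_eq hm]
    ext z
    exact (hB z).symm
  rw [numDistinctZeros, h1, Set.ncard_coe_finset]

end ZeroCount

/-! ### The main theorem -/

theorem mainTheorem12 (a : ℝ) (h : ℂ → ℂ) (hmer : Meromorphic h)
    (hpoles : (ZeroCount.polesIn h Set.univ).Finite)
    (hzeros : (ZeroCount.zerosIn h (ZeroCount.rightHalfPlane a)).Finite)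
    (hline : ∀ s : ℂ, s.re = a → meromorphicOrderAt h s = 0)
    (hi : ∀ η : ℝ, 0 < η → ∃ σ₀ : ℝ, a < σ₀ ∧ ∀ s : ℂ, σ₀ ≤ s.re →
      ZeroCount.AbsLt (ZeroCount.symQuotient a h) s η)
    (hii : ∀ ε : ℝ, 0 < ε → ∀ σ₀ : ℝ, a < σ₀ → ∃ T T' : ℕ → ℝ,
      Tendsto T atTop atTop ∧ Tendsto T' atTop atTop ∧
      ∀ n : ℕ, ∀ s : ℂ, a ≤ s.re → s.re ≤ σ₀ → (s.im = T n ∨ s.im = -T' n) →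
        ZeroCount.AbsLt (ZeroCount.symQuotient a h) s (Real.exp (ε * ‖s‖)))
    (sgn : ℂ) (hsgn : sgn = 1 ∨ sgn = -1)
    (f : ℂ → ℂ) (hf : f = ZeroCount.symmetrized a sgn h) :
    -- the functional equation of `f`
    (∀ s : ℂ, ZeroCount.conjFun f (2 * (a : ℂ) - s) = sgn * f s) ∧
    -- the poles of `f` to the right of the critical line are finite in number
    (ZeroCount.polesIn f (ZeroCount.rightHalfPlane a)).Finite ∧
    -- the counting functions are finite and satisfy the estimates
    (∀ T : ℝ, 0 < T →
      (ZeroCount.zerosIn f (ZeroCount.strip T)).Finite ∧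
      ZeroCount.numZeros f (ZeroCount.strip T)
          - ZeroCount.numZeros f (ZeroCount.criticalSegment a T)
        ≤ ZeroCount.numZeros f (ZeroCount.strip T)
          - ZeroCount.numDistinctZeros f (ZeroCount.criticalSegment a T) ∧
      ZeroCount.numZeros f (ZeroCount.strip T)
          - ZeroCount.numDistinctZeros f (ZeroCount.criticalSegment a T)
        ≤ 1 + 2 * ZeroCount.numPoles f (ZeroCount.rightHalfPlane a)
            + 2 * ZeroCount.numZeros h (ZeroCount.rightHalfPlane a)
            - 2 * ZeroCount.numPoles h (ZeroCount.rightHalfPlane a) ∧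
      0 ≤ ZeroCount.numZeros f (ZeroCount.strip T)
          - ZeroCount.numZeros f (ZeroCount.criticalSegment a T) ∧
      Even (ZeroCount.numZeros f (ZeroCount.strip T)
          - ZeroCount.numZeros f (ZeroCount.criticalSegment a T))) ∧
    -- all but finitely many zeros of `f` are on the critical line and simple
    {z : ℂ | 0 < meromorphicOrderAt f z ∧
      ¬ (z.re = a ∧ meromorphicOrderAt f z = 1)}.Finite := by
  classical
  have hsgn1 : ‖sgn‖ = 1 := by rcases hsgn with rfl | rfl <;> simp
  set W := ZeroCount.cofactor a sgn h with hW
  have hhtop : ∀ z, meromorphicOrderAt h z ≠ ⊤ :=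
    ZeroCount.meromorphicOrderAt_ne_top_of_line hmer hline
  have hWtop : ∀ z, meromorphicOrderAt W z ≠ ⊤ :=
    ZeroCount.meromorphicOrderAt_cofactor_ne_top hsgn1 hmer hi
  have hford : ∀ z, meromorphicOrderAt f z = meromorphicOrderAt h z + meromorphicOrderAt W z := by
    rw [hf]
    exact ZeroCount.meromorphicOrderAt_symmetrized hmer hline
  have hftop : ∀ z, meromorphicOrderAt f z ≠ ⊤ := fun z => by
    rw [hford]
    exact WithTop.add_ne_top.2 ⟨hhtop z, hWtop z⟩
  have hfmer : Meromorphic f := hf ▸ ZeroCount.meromorphic_symmetrized a sgn hmer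
  set oh : ℂ → ℤ := fun z => (meromorphicOrderAt h z).untop₀ with hoh
  set ow : ℂ → ℤ := fun z => (meromorphicOrderAt W z).untop₀ with how
  set of : ℂ → ℤ := fun z => (meromorphicOrderAt f z).untop₀ with hof
  have hadd : ∀ z, of z = oh z + ow z := fun z => by
    simp only [hof, hoh, how, hford]
    exact WithTop.untop₀_add (hhtop z) (hWtop z)
  have hhl : ∀ z : ℂ, z.re = a → oh z = 0 := fun z hz => by simp [hoh, hline z hz]
  have howc : ∀ z, (ow z : WithTop ℤ) = meromorphicOrderAt W z := fun z =>
    WithTop.coe_untop₀_of_ne_top (hWtop z)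
  have hohc : ∀ z, (oh z : WithTop ℤ) = meromorphicOrderAt h z := fun z =>
    WithTop.coe_untop₀_of_ne_top (hhtop z)
  have hofc : ∀ z, (of z : WithTop ℤ) = meromorphicOrderAt f z := fun z =>
    WithTop.coe_untop₀_of_ne_top (hftop z)
  have hWan : ∀ z : ℂ, z.re = a → AnalyticAt ℂ W z := fun z hz =>
    ZeroCount.analyticAt_cofactor (ZeroCount.analyticAt_regQuotient_line hmer hline hz)
  have hwl : ∀ z : ℂ, z.re = a → 0 ≤ ow z := fun z hz => by
    have h1 := (hWan z hz).meromorphicOrderAt_nonneg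
    rw [← howc] at h1
    exact_mod_cast h1
  have hsym : ∀ z, of (ZeroCount.mirror a z) = of z := fun z => by
    simp only [hof, hf, ZeroCount.meromorphicOrderAt_symmetrized_mirror hsgn hmer]
  have hcore : ∀ A : Finset ℂ, (∀ p ∈ A, a ≤ p.re) → ∀ e : ℂ → ℤ,
      (∀ p ∈ A, (if p.re = a then 2 else 1) * e p ≤ ow p) →
      (∀ z : ℂ, a ≤ z.re → z ∉ A → 0 ≤ ow z) → ∑ p ∈ A, e p ≤ 0 := by
    intro A hA e he1 he2
    refine ZeroCount.sum_exponents_nonpos (a := a) (W := W)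
      (ZeroCount.meromorphic_cofactor a sgn h) ?_ (fun z hz => ⟨hWan z hz, ?_⟩)
      (ZeroCount.infinite_pos_cofactor hsgn1 hmer hline hi) A hA e (fun p hp => ?_)
      (fun z hz hzA => ?_)
    · obtain ⟨M, ρ, hM⟩ :=
        ZeroCount.exists_bound_regQuotient hmer hpoles hzeros hline hi hii
      refine ⟨1 + M, ρ, fun z hz hzρ => ⟨ZeroCount.analyticAt_cofactor (hM z hz hzρ).1, ?_⟩⟩
      rw [hW, ZeroCount.cofactor]
      refine (norm_add_le _ _).trans ?_
      rw [norm_one, norm_mul, hsgn1, one_mul]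
      linarith [(hM z hz hzρ).2]
    · exact (ZeroCount.cofactor_line hsgn1 hmer hline hz).1
    · rw [← howc]
      exact WithTop.coe_le_coe.2 (he1 p hp)
    · rw [← howc]
      exact_mod_cast he2 z hz hzA
  have hfinW : {z : ℂ | a ≤ z.re ∧ ow z < 0}.Finite := by
    refine (ZeroCount.finite_poles_cofactor sgn hmer hline hpoles hzeros).subset
      fun z hz => ⟨hz.1, ?_⟩
    rw [← hW, ← howc]
    exact_mod_cast hz.2
  have hfinH : {z : ℂ | a < z.re ∧ oh z ≠ 0}.Finite := by
    refine (hzeros.union hpoles).subset fun z hz => ?_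
    rcases lt_or_gt_of_ne hz.2 with h1 | h1
    · refine Or.inr ⟨trivial, ?_⟩
      rw [← hohc]
      exact_mod_cast h1
    · refine Or.inl ⟨hz.1, ?_⟩
      rw [← hohc]
      exact_mod_cast h1
  have hexc : {z : ℂ | 0 < of z ∧ ¬ (z.re = a ∧ of z = 1)}.Finite :=
    ZeroCount.finite_exceptional hsym
      (ZeroCount.finite_exceptional_right hadd hhl hcore hfinH hfinW)
  refine ⟨fun s => ?_, ?_, fun T _ => ?_, ?_⟩
  · rw [hf]
    exact ZeroCount.reflected_symmetrized hsgn s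
  · rw [ZeroCount.polesIn_eq hftop]
    refine (hfinH.union hfinW).subset fun z hz => ?_
    have h1 : of z < 0 := hz.2
    have h2 := hadd z
    have h3 : a < z.re := hz.1
    by_cases h4 : ow z < 0
    · exact Or.inr ⟨h3.le, h4⟩
    · exact Or.inl ⟨h3, by omega⟩
  · have hstrip : (ZeroCount.zerosIn f (ZeroCount.strip T)).Finite := by
      rw [ZeroCount.zerosIn_eq hftop]
      refine (hexc.union (ZeroCount.finite_zeros_segment hfmer a T)).subset fun z hz => ?_
      by_cases h1 : z.re = a
      · exact Or.inr ⟨⟨h1, hz.1⟩, hz.2⟩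
      · exact Or.inl ⟨hz.2, fun h2 => h1 h2.1⟩
    set B := hstrip.toFinset with hBdef
    have hB : ∀ z, z ∈ B ↔ z ∈ ZeroCount.strip T ∧ 0 < of z := fun z => by
      rw [hBdef, Set.Finite.mem_toFinset, ZeroCount.zerosIn_eq hftop]
      rfl
    have hBl : ∀ z, z ∈ B.filter (fun z => z.re = a) ↔
        z ∈ ZeroCount.criticalSegment a T ∧ 0 < of z := fun z => by
      rw [Finset.mem_filter, hB]
      exact ⟨fun hz => ⟨⟨hz.2, hz.1.1⟩, hz.1.2⟩, fun hz => ⟨⟨hz.1.2, hz.2⟩, hz.1.1⟩⟩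
    have hBsym : ∀ z, z ∈ B ↔ ZeroCount.mirror a z ∈ B := fun z => by
      rw [hB, hB, hsym]
      simp [ZeroCount.strip]
    have hsplit := ZeroCount.sum_eq_line_add_two_mul_right hsym B hBsym
    have hcount := ZeroCount.right_and_line_count_le hadd hhl hwl hcore hfinH hfinW B
      (fun z hz => ((hB z).1 hz).2)
    have hpos : ∀ z ∈ B, 1 ≤ of z := fun z hz => ((hB z).1 hz).2
    have hright : 0 ≤ ∑ z ∈ B with a < z.re, of z :=
      Finset.sum_nonneg fun z hz => by linarith [hpos z (Finset.mem_filter.1 hz).1]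
    have hlineCard : ((B.filter (fun z => z.re = a)).card : ℤ) ≤ ∑ z ∈ B with z.re = a, of z := by
      have h1 := Finset.card_nsmul_le_sum (B.filter (fun z => z.re = a)) of 1
        (fun z hz => hpos z (Finset.mem_filter.1 hz).1)
      simpa using h1
    rw [Finset.sum_sub_distrib] at hcount
    simp only [Finset.sum_const, nsmul_eq_mul, mul_one] at hcount
    have hP : ∀ m : ℂ → ℂ, (∀ z, meromorphicOrderAt m z ≠ ⊤) →
        ZeroCount.numPoles m (ZeroCount.rightHalfPlane a) =
          ∑ᶠ z ∈ {z : ℂ | a < z.re ∧ (meromorphicOrderAt m z).untop₀ < 0},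
            -(meromorphicOrderAt m z).untop₀ := fun m hm => by
      rw [ZeroCount.numPoles, ZeroCount.polesIn_eq hm]
      rfl
    have hZ : ZeroCount.numZeros h (ZeroCount.rightHalfPlane a) =
        ∑ᶠ z ∈ {z : ℂ | a < z.re ∧ 0 < oh z}, oh z := by
      rw [ZeroCount.numZeros, ZeroCount.zerosIn_eq hhtop]
      rfl
    rw [ZeroCount.numZeros_eq_sum hftop B hB, ZeroCount.numZeros_eq_sum hftop _ hBl,
      ZeroCount.numDistinctZeros_eq_card hftop _ hBl, hP f hftop, hP h hhtop, hZ]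
    refine ⟨hstrip, by linarith, ?_, by linarith, ?_⟩
    -- `hcount` and `hsplit` give the bound without the summand 1.
    · linarith
    · exact ⟨∑ z ∈ B with a < z.re, of z, by linarith⟩
  · refine hexc.subset fun z hz => ?_
    have h1 := hz.1
    rw [← hofc] at h1
    refine ⟨by exact_mod_cast h1, fun h2 => hz.2 ⟨h2.1, ?_⟩⟩
    rw [← hofc, h2.2]
    rfl
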